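/- Let $X$ be a compact metric space and $T\colon X\to X$ a continuous map. For $Z\subseteq X$ let $h_{\rm top}(Z)\in[0,\infty]$ be Bowen's topological entropy: with $B_n(x,\varepsilon)=\{y: d(T^jx,T^jy)<\varepsilon,\ 0\le j<n\}$, put $$H^s(Z,\varepsilon)=\lim_{N\to\infty}\ \inf\Bigl\{\sum_i e^{-sn_i}\Bigr\}\qquad(s\ge 0),$$ where the infimum is over all at most countable covers $\{B_{n_i}(x_i,\varepsilon)\}_i$ of $Z$ with all $n_i\ge \max(N,1)$; let $h_{\rm top}(Z,\varepsilon)=\inf\{s\ge0: H^s(Z,\varepsilon)=0\}$ be the critical value, and $h_{\rm top}(Z)=\lim_{\varepsilon\to0}h_{\rm top}(Z,\varepsilon)$. Let $\mathcal M_{\rm inv}$ be the set of $T$-invariant Borel probability measures on $X$, and let $h_\mu\in[0,\infty]$ be the measure-theoretic (Kolmogorov–Sinai) entropy of $\mu\in\mathcal M_{\rm inv}$. Let $G_\mu$ be the set of $x\in X$ such that $\frac1n\sum_{j=0}^{n-1}\delta_{T^jx}\to\mu$ in the weak-* topology. The system $(X,T)$ is called saturated if $h_{\rm top}(G_\mu)=h_\mu$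 for every $\mu\in\mathcal M_{\rm inv}$. For a real Banach space $\mathbb B$, a map $\Phi\colon X\to\mathbb B^*$ that is continuous for the weak-* topology $\sigma(\mathbb B^*,\mathbb B)$, $\alpha\in\mathbb B^*$ and $E\subseteq\mathbb B$, let $A_n\Phi(x)=\frac1n\sum_{j=0}^{n-1}\Phi(T^jx)$ and $$X_\Phi(\alpha;E)=\Bigl\{x\in X:\ \limsup_{n\to\infty}\langle A_n\Phi(x),w\rangle\le\langle\alpha,w\rangle\ \text{ for all } w\in E\Bigr\},$$ $$\mathcal M_\Phi(\alpha;E)=\Bigl\{\mu\in\mathcal M_{\rm inv}:\ \int\langle\Phi,w\rangle\,d\mu\le\langle\alpha,w\rangle\ \text{ for all } w\in E\Bigr\}.$$ **Theorem.** The system $(X,T)$ is saturated if and only if the following variational principle holds: for every real Banach space $\mathbb B$, every weak-* continuous $\Phi\colon X\to\mathbb B^*$, every $\alpha\in\mathbb B^*$ and every $E\subseteq\mathbb B$ with $\mathcal M_\Phi(\alpha;E)\neq\emptyset$, $$h_{\rm top}\bigl(X_\Phi(\alpha;E)\bigr)=\sup_{\mu\in\mathcal M_\Phi(\alpha;E)}h_\mu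 .$$ -/

import Mathlib

open MeasureTheory Filter Topology
open scoped ENNReal NNReal

namespace SaturatedSystem

/-! ### Bowen's topological entropy of a subset -/

section TopologicalEntropy

variable {X : Type*} [MetricSpace X]

/-- The open ball `B_n(x, ε)` of the Bowen metric `d_n(x, y) = max_{0 ≤ j < n} d(T^j x, T^j y)`. -/
def bowenBall (T : X → X) (n : ℕ) (x : X) (ε : ℝ) : Set X :=
  {y | ∀ j < n, dist (T^[j] y) (T^[j] x) < ε}

/-- `R`, a set of pairs `(nᵢ, xᵢ)`, is an at most countable family of Bowen balls
`B_{nᵢ}(xᵢ, ε)`, `nᵢ ≥ 1`, which covers `Z` and satisfies `nᵢ ≥ N` for all `i`. -/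
structure IsBowenCover (T : X → X) (Z : Set X) (ε : ℝ) (N : ℕ) (R : Set (ℕ × X)) : Prop where
  countable : R.Countable
  pos : ∀ p ∈ R, 1 ≤ p.1
  le : ∀ p ∈ R, N ≤ p.1
  cover : Z ⊆ ⋃ p ∈ R, bowenBall T p.1 p.2 ε

/-- The sum `∑ᵢ exp(-s nᵢ)` over a family of pairs `(nᵢ, xᵢ)`. -/
noncomputable def coverWeight (s : ℝ≥0) (R : Set (ℕ × X)) : ℝ≥0∞ :=
  ∑' p : R, ENNReal.ofReal (Real.exp (-((s : ℝ) * (p.1.1 : ℝ))))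

/-- `H^s_N(Z, ε)`. -/
noncomputable def bowenPremeasure (T : X → X) (s : ℝ≥0) (Z : Set X) (ε : ℝ) (N : ℕ) : ℝ≥0∞ :=
  ⨅ (R : Set (ℕ × X)) (_ : IsBowenCover T Z ε N R), coverWeight s R

/-- `H^s(Z, ε) = lim_{N → ∞} H^s_N(Z, ε)`, a monotone limit
(see `tendsto_bowenPremeasure`). -/
noncomputable def bowenMeasure (T : X → X) (s : ℝ≥0) (Z : Set X) (ε : ℝ) : ℝ≥0∞ :=
  ⨆ N : ℕ, bowenPremeasure T s Z ε N

/-- `h_top(Z, ε)`, the critical value of `s ↦ H^s(Z, ε)`, `s ≥ 0`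
(see `bowenMeasure_eq_zero` and `bowenMeasure_eq_top`). -/
noncomputable def topEntropyAt (T : X → X) (Z : Set X) (ε : ℝ) : ℝ≥0∞ :=
  ⨅ (s : ℝ≥0) (_ : bowenMeasure T s Z ε = 0), (s : ℝ≥0∞)

/-- `h_top(Z) = lim_{ε → 0+} h_top(Z, ε)`, a monotone limit (see `tendsto_topEntropyAt`). -/
noncomputable def topEntropy (T : X → X) (Z : Set X) : ℝ≥0∞ :=
  ⨆ (ε : ℝ) (_ : 0 < ε), topEntropyAt T Z ε

theorem bowenPremeasure_mono (T : X → X) (s : ℝ≥0) (Z : Set X) (ε : ℝ) :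
    Monotone (bowenPremeasure T s Z ε) := fun _ _ h =>
  le_iInf₂ fun R hR =>
    iInf₂_le R ⟨hR.countable, hR.pos, fun p hp => h.trans (hR.le p hp), hR.cover⟩

theorem tendsto_bowenPremeasure (T : X → X) (s : ℝ≥0) (Z : Set X) (ε : ℝ) :
    Tendsto (bowenPremeasure T s Z ε) atTop (𝓝 (bowenMeasure T s Z ε)) :=
  tendsto_atTop_iSup (bowenPremeasure_mono T s Z ε)

theorem bowenPremeasure_le_exp_mul (T : X → X) {s t : ℝ≥0} (h : s ≤ t) (Z : Set X) (ε : ℝ)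
    (N : ℕ) : bowenPremeasure T t Z ε N ≤
      ENNReal.ofReal (Real.exp (-(((t : ℝ) - s) * N))) * bowenPremeasure T s Z ε N := by
  have h0 : ENNReal.ofReal (Real.exp (-(((t : ℝ) - s) * N))) ≠ 0 := by
    simpa using Real.exp_pos _
  unfold bowenPremeasure
  rw [ENNReal.mul_iInf_of_ne h0 ENNReal.ofReal_ne_top]
  refine le_iInf fun R => ?_
  rw [ENNReal.mul_iInf_of_ne h0 ENNReal.ofReal_ne_top]
  refine le_iInf fun hR => (iInf₂_le R hR).trans ?_
  unfold coverWeight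
  rw [← ENNReal.tsum_mul_left]
  refine ENNReal.tsum_le_tsum fun p => ?_
  rw [← ENNReal.ofReal_mul (Real.exp_pos _).le, ← Real.exp_add]
  refine ENNReal.ofReal_le_ofReal (Real.exp_le_exp.2 ?_)
  have h1 : (N : ℝ) ≤ (p.1.1 : ℝ) := by exact_mod_cast hR.le p.1 p.2
  have h2 : (0 : ℝ) ≤ (t : ℝ) - s := sub_nonneg.2 (by exact_mod_cast h)
  nlinarith [mul_le_mul_of_nonneg_left h1 h2]

theorem bowenMeasure_eq_zero_of_lt (T : X → X) {s t : ℝ≥0} (h : s < t) (Z : Set X) (ε : ℝ)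
    (hs : bowenMeasure T s Z ε ≠ ⊤) : bowenMeasure T t Z ε = 0 := by
  have h2 : (0 : ℝ) < (t : ℝ) - s := sub_pos.2 (by exact_mod_cast h)
  have key : Tendsto (fun N : ℕ => ENNReal.ofReal (Real.exp (-(((t : ℝ) - s) * N))) *
      bowenMeasure T s Z ε) atTop (𝓝 0) := by
    have h3 : Tendsto (fun N : ℕ => Real.exp (-(((t : ℝ) - s) * N))) atTop (𝓝 0) :=
      Real.tendsto_exp_neg_atTop_nhds_zero.comp
        (tendsto_natCast_atTop_atTop.const_mul_atTop h2)
    have h4 := ENNReal.Tendsto.mul_const (ENNReal.tendsto_ofReal h3)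
      (Or.inr hs : _ ∨ bowenMeasure T s Z ε ≠ ⊤)
    simpa using h4
  refine le_antisymm (le_of_tendsto_of_tendsto' (tendsto_bowenPremeasure T t Z ε) key
    fun N => ?_) zero_le
  exact (bowenPremeasure_le_exp_mul T h.le Z ε N).trans
    (mul_le_mul_right (le_iSup (bowenPremeasure T s Z ε) N) _)

theorem bowenMeasure_eq_zero (T : X → X) (Z : Set X) (ε : ℝ) (s : ℝ≥0)
    (h : topEntropyAt T Z ε < s) : bowenMeasure T s Z ε = 0 := by
  simp only [topEntropyAt, iInf_lt_iff] at h
  obtain ⟨r, hr, hrs⟩ := h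
  exact bowenMeasure_eq_zero_of_lt T (by exact_mod_cast hrs) Z ε (by simp [hr])

theorem bowenMeasure_eq_top (T : X → X) (Z : Set X) (ε : ℝ) (s : ℝ≥0)
    (h : (s : ℝ≥0∞) < topEntropyAt T Z ε) : bowenMeasure T s Z ε = ⊤ := by
  by_contra hs
  obtain ⟨r, hsr, hr⟩ := ENNReal.lt_iff_exists_nnreal_btwn.1 h
  exact absurd (iInf₂_le r (bowenMeasure_eq_zero_of_lt T (by exact_mod_cast hsr) Z ε hs))
    (not_le.2 hr)

theorem topEntropyAt_anti (T : X → X) (Z : Set X) : Antitone (topEntropyAt T Z) := by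
  intro ε δ h
  refine le_iInf₂ fun s hs => ?_
  suffices hle : bowenMeasure T s Z δ ≤ bowenMeasure T s Z ε from
    iInf_le_of_le s (iInf_le _ (le_antisymm (hle.trans hs.le) zero_le))
  refine iSup_mono fun N => le_iInf₂ fun R hR => iInf₂_le R
    ⟨hR.countable, hR.pos, hR.le, hR.cover.trans ?_⟩
  exact Set.iUnion₂_mono fun p _ y hy j hj => (hy j hj).trans_le h

theorem tendsto_topEntropyAt (T : X → X) (Z : Set X) :
    Tendsto (topEntropyAt T Z) (𝓝[>] 0) (𝓝 (topEntropy T Z)) := by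
  have h := (topEntropyAt_anti T Z).tendsto_nhdsGT 0
  rwa [sSup_image] at h

end TopologicalEntropy

/-! ### Measure-theoretic entropy, invariant measures, generic points -/

section Measures

variable {X : Type*} [MeasurableSpace X]

/-- Shannon entropy of the join `⋁_{i < n} T^{-i} P` of a finite measurable partition, which is
given as the level sets of a map `P : X → Fin k`: the atoms of the join are the level sets of
`x ↦ (P (T^i x))_{i < n}`, and `Real.negMulLog t = -t log t`. -/
noncomputable def joinEntropy (T : X → X) (μ : Measure X) {k : ℕ} (P : X → Fin k) (n : ℕ) : ℝ :=
  ∑ a : Fin n → Fin k, Real.negMulLog (μ.real {x | ∀ i : Fin n, P (T^[i] x) = a i})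

/-- Entropy of `T` relative to the partition `P`: the limit of `n⁻¹ H(⋁_{i < n} T^{-i} P)`,
which exists, by subadditivity, when `μ` is invariant. -/
noncomputable def partitionEntropy (T : X → X) (μ : Measure X) {k : ℕ} (P : X → Fin k) : ℝ≥0∞ :=
  limsup (fun n : ℕ => ENNReal.ofReal (joinEntropy T μ P n / n)) atTop

/-- The Kolmogorov–Sinai entropy `h_μ`: the supremum over all finite measurable partitions. -/
noncomputable def measureEntropy (T : X → X) (μ : Measure X) : ℝ≥0∞ :=
  ⨆ (k : ℕ) (P : X → Fin k) (_ : Measurable P), partitionEntropy T μ P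

/-- The set of `T`-invariant probability measures. -/
def invariantMeasures (T : X → X) : Set (ProbabilityMeasure X) :=
  {μ | MeasurePreserving T (μ : Measure X) (μ : Measure X)}

/-- The empirical measure `(n + 1)⁻¹ ∑_{j = 0}^{n} δ_{T^j x}`. -/
noncomputable def empiricalMeasure (T : X → X) (x : X) (n : ℕ) : ProbabilityMeasure X :=
  ⟨((n + 1 : ℕ) : ℝ≥0∞)⁻¹ • ∑ j ∈ Finset.range (n + 1), Measure.dirac (T^[j] x), ⟨by
    simp only [Measure.smul_apply, Measure.finsetSum_apply, measure_univ, Finset.sum_const,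
      Finset.card_range, smul_eq_mul, nsmul_eq_mul, mul_one]
    exact ENNReal.inv_mul_cancel (by simp) (ENNReal.natCast_ne_top _)⟩⟩

/-- The set `G_μ` of `μ`-generic points; the topology on `ProbabilityMeasure X` is that of weak
convergence (against bounded continuous functions). -/
def genericPoints [TopologicalSpace X] [OpensMeasurableSpace X] (T : X → X)
    (μ : ProbabilityMeasure X) : Set X :=
  {x | Tendsto (empiricalMeasure T x) atTop (𝓝 μ)}

/-- `h_top(G_μ) = h_μ` for every invariant probability measure `μ`. -/
def IsSaturated {X : Type*} [MetricSpace X] [MeasurableSpace X] [BorelSpace X]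
    (T : X → X) : Prop :=
  ∀ μ ∈ invariantMeasures T, topEntropy T (genericPoints T μ) = measureEntropy T (μ : Measure X)

end Measures

/-! ### Banach-valued Birkhoff averages

`WeakDual ℝ B` is the dual of `B` with the topology `σ(B*, B)`. -/

section Birkhoff

variable {X : Type*} {B : Type*} [NormedAddCommGroup B] [NormedSpace ℝ B]

/-- `X_Φ(α; E)`: the points with `limsup_n ⟨A_n Φ(x), w⟩ ≤ ⟨α, w⟩` for all `w ∈ E`, where
`A_n Φ(x) = n⁻¹ ∑_{j < n} Φ(T^j x)`. -/
def birkhoffSet (T : X → X) (Φ : X → WeakDual ℝ B) (α : WeakDual ℝ B) (E : Set B) : Set X :=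
  {x | ∀ w ∈ E, limsup (fun n : ℕ => birkhoffAverage ℝ T Φ n x w) atTop ≤ α w}

/-- `M_Φ(α; E)`: the invariant probability measures with `∫ ⟨Φ, w⟩ dμ ≤ ⟨α, w⟩` for all
`w ∈ E`. -/
def birkhoffMeasures [MeasurableSpace X] (T : X → X) (Φ : X → WeakDual ℝ B)
    (α : WeakDual ℝ B) (E : Set B) : Set (ProbabilityMeasure X) :=
  {μ | μ ∈ invariantMeasures T ∧ ∀ w ∈ E, ∫ x, Φ x w ∂(μ : Measure X) ≤ α w}

end Birkhoff

end SaturatedSystem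

/-!
Let `V(x)` be the set of limit measures of the empirical measures of `x`. Then
`x ∈ X_Φ(α; E)` iff `V(x) ⊆ M_Φ(α; E)`, and `x ∈ G_μ` iff `V(x) ⊆ {μ}`. Since `V(x)` is nonempty,
Bowen's bound `h_top {x | ∃ μ ∈ V(x), h_μ ≤ t} ≤ t` gives the inequality `≤` in the variational
principle, for every system; saturation gives `≥`, because `G_μ ⊆ X_Φ(α; E)` for
`μ ∈ M_Φ(α; E)`. Conversely, the embedding `Φ` of `X` into the dual of `C(X)` and `α = ∫ · dμ`
satisfy `M_Φ(α; C(X)) = {μ}` and `X_Φ(α; C(X)) = G_μ`, so the variational principle specializes to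
saturation at `μ`.

For Bowen's bound, let `h_μ < s` and take a partition into small pieces with `μ`-null boundaries.
Some increment `H(m + 1) - H(m)` of its join entropy is below `s`; this is the conditional entropy
of a letter given the `m` preceding ones, hence the mean cost under `μ` of a code which satisfies
Kraft's inequality after each word of length `m`. The boundaries being null, the mean cost stays
below `s` for all measures in a weak neighbourhood `W` of `μ`. Points with infinitely many
empirical measures in `W` are covered by the Bowen balls of the names of length `n` and cost at most
`s n`, and Kraft's inequality bounds the number of these exponentially, at rate `s`. Countably many
such `W` suffice, and Bowen's entropy is countably stable.
-/

namespace SaturatedSystem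

section Words

variable {A : Type*}

/-- `φ` assigns conditional code lengths, in nats, to the letters of `A`: after each word `b` of
length `m`, the lengths `φ (b c)` of the next letter `c` satisfy Kraft's inequality. -/
def IsConditionalCode [Fintype A] {m : ℕ} (φ : (Fin (m + 1) → A) → ℝ) : Prop :=
  ∀ b : Fin m → A, ∑ c, Real.exp (-φ (Fin.snoc (α := fun _ => A) b c)) ≤ 1

/-- The length of the code which `φ` gives to the last `n` letters of a word of length `m + n`,
its first `m` letters being known. -/
def wordCost {m : ℕ} (φ : (Fin (m + 1) → A) → ℝ) (n : ℕ) (a : Fin (m + n) → A) : ℝ :=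
  ∑ j : Fin n, φ fun i => a ⟨j + i, by lia⟩

theorem sum_words_snoc [Fintype A] {M : Type*} [AddCommMonoid M] {n : ℕ}
    (f : (Fin (n + 1) → A) → M) :
    ∑ a, f a = ∑ b : Fin n → A, ∑ c, f (Fin.snoc (α := fun _ => A) b c) := by
  rw [← (Fin.snocEquiv fun _ : Fin (n + 1) => A).sum_comp, Fintype.sum_prod_type,
    Finset.sum_comm]
  rfl

theorem wordCost_snoc {m n : ℕ} (φ : (Fin (m + 1) → A) → ℝ) (b : Fin (m + n) → A) (c : A) :
    wordCost φ (n + 1) (Fin.snoc (α := fun _ => A) b c) =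
      wordCost φ n b + φ (Fin.snoc (α := fun _ => A) (fun i => b ⟨n + i, by lia⟩) c) := by
  unfold wordCost
  rw [Fin.sum_univ_castSucc]
  congr! 3 with j _ i
  · funext i
    have hi : (j : ℕ) + i < m + n := by lia
    simp [Fin.snoc, hi]
  · refine Fin.lastCases ?_ (fun i => ?_) i
    · simp [Fin.snoc, add_comm]
    · have hi : n + (i : ℕ) < m + n := by lia
      simp [Fin.snoc, hi]

theorem IsConditionalCode.sum_exp_neg_wordCost_le [Fintype A] {m : ℕ}
    {φ : (Fin (m + 1) → A) → ℝ} (hφ : IsConditionalCode φ) (n : ℕ) :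
    ∑ a, Real.exp (-wordCost φ n a) ≤ (Fintype.card A : ℝ) ^ m := by
  induction n with
  | zero => simp [wordCost]
  | succ n ih =>
    refine le_trans ?_ ih
    change ∑ a : Fin (m + n + 1) → A, Real.exp (-wordCost φ (n + 1) a) ≤ _
    rw [sum_words_snoc]
    refine Finset.sum_le_sum fun b _ => ?_
    simp only [wordCost_snoc, neg_add, Real.exp_add, ← Finset.mul_sum]
    exact mul_le_of_le_one_right (Real.exp_pos _).le (hφ _)

end Words

section Kraft

variable {κ : Type*} [Fintype κ] {p : κ → ℝ}

theorem sum_mul_neg_log_div_sum (hp : ∀ c, 0 ≤ p c) :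
    ∑ c, p c * -Real.log (p c / ∑ c', p c') =
      ∑ c, Real.negMulLog (p c) - Real.negMulLog (∑ c, p c) := by
  have hterm : ∀ c, p c * -Real.log (p c / ∑ c', p c') =
      Real.negMulLog (p c) + p c * Real.log (∑ c', p c') := by
    intro c
    rcases (hp c).eq_or_lt with h0 | h0
    · simp [← h0]
    · have hsum : 0 < ∑ c', p c' :=
        h0.trans_le (Finset.single_le_sum (fun c _ => hp c) (Finset.mem_univ c))
      rw [Real.log_div h0.ne' hsum.ne', Real.negMulLog]
      ring
  rw [Finset.sum_congr rfl fun c _ => hterm c, Finset.sum_add_distrib, ← Finset.sum_mul,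
    Real.negMulLog]
  ring

theorem tendsto_sum_mul_neg_log_smoothed (hp : ∀ c, 0 ≤ p c) :
    Tendsto (fun η : ℝ => ∑ c, p c * -Real.log ((p c + η) / ∑ c', (p c' + η))) (𝓝[>] 0)
      (𝓝 (∑ c, p c * -Real.log (p c / ∑ c', p c'))) := by
  refine tendsto_finsetSum _ fun c _ => ?_
  rcases (hp c).eq_or_lt with h0 | h0
  · simp [← h0]
  · have hsum : ∑ c', p c' ≠ 0 :=
      (h0.trans_le (Finset.single_le_sum (fun c _ => hp c) (Finset.mem_univ c))).ne'
    have hcont : ContinuousAt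
        (fun η : ℝ => p c * -Real.log ((p c + η) / ∑ c', (p c' + η))) 0 := by
      refine continuousAt_const.mul (ContinuousAt.neg (ContinuousAt.log ?_ ?_))
      · exact ContinuousAt.div (by fun_prop) (by fun_prop) (by simpa using hsum)
      · simpa using ⟨h0.ne', hsum⟩
    simpa using hcont.tendsto.mono_left nhdsWithin_le_nhds

theorem exists_kraft_sum_mul_lt (hp : ∀ c, 0 ≤ p c) {h : ℝ}
    (hh : ∑ c, Real.negMulLog (p c) - Real.negMulLog (∑ c, p c) < h) :
    ∃ ℓ : κ → ℝ, ∑ c, Real.exp (-ℓ c) ≤ 1 ∧ ∑ c, p c * ℓ c < h := by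
  -- The lengths `-log (p c / ∑ p)` are optimal, but where `p c = 0` the junk value `log 0 = 0`
  -- makes them violate Kraft's inequality; hence the smoothing `p c + η`.
  rw [← sum_mul_neg_log_div_sum hp] at hh
  obtain ⟨η, hη, hη0 : 0 < η⟩ := (((tendsto_sum_mul_neg_log_smoothed hp).eventually
    (gt_mem_nhds hh)).and self_mem_nhdsWithin).exists
  refine ⟨fun c => -Real.log ((p c + η) / ∑ c', (p c' + η)), ?_, hη⟩
  have hpos : ∀ c, 0 < p c + η := fun c => add_pos_of_nonneg_of_pos (hp c) hη0
  have hexp : ∀ c, Real.exp (- -Real.log ((p c + η) / ∑ c', (p c' + η))) =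
      (p c + η) / ∑ c', (p c' + η) := fun c => by
    rw [neg_neg, Real.exp_log]
    exact div_pos (hpos c) (Finset.sum_pos (fun c _ => hpos c) ⟨c, Finset.mem_univ c⟩)
  simp only [hexp, ← Finset.sum_div]
  exact div_self_le_one _

theorem exists_kraft_sum_sum_mul_lt {ι : Type*} [Fintype ι] {p : ι → κ → ℝ}
    (hp : ∀ b c, 0 ≤ p b c) {s : ℝ}
    (hs : ∑ b, ∑ c, Real.negMulLog (p b c) - ∑ b, Real.negMulLog (∑ c, p b c) < s) :
    ∃ ℓ : ι → κ → ℝ, (∀ b, ∑ c, Real.exp (-ℓ b c) ≤ 1) ∧ ∑ b, ∑ c, p b c * ℓ b c < s := by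
  obtain ⟨δ, hδ, hcard⟩ := exists_pos_mul_lt (sub_pos.2 hs) (Fintype.card ι : ℝ)
  choose ℓ hkraft hcost using fun b => exists_kraft_sum_mul_lt (hp b) (lt_add_of_pos_right _ hδ)
  refine ⟨ℓ, hkraft, ?_⟩
  calc ∑ b, ∑ c, p b c * ℓ b c
      ≤ ∑ b, (∑ c, Real.negMulLog (p b c) - Real.negMulLog (∑ c, p b c) + δ) :=
        Finset.sum_le_sum fun b _ => (hcost b).le
    _ < s := by
        rw [Finset.sum_add_distrib, Finset.sum_sub_distrib, Finset.sum_const, Finset.card_univ,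
          nsmul_eq_mul]
        linarith

end Kraft

section Itineraries

variable {X A : Type*}

/-- The name of length `n` of `x` relative to the partition into the level sets of `P`. -/
def itinerary (T : X → X) (P : X → A) (n : ℕ) (x : X) : Fin n → A :=
  fun i => P (T^[i] x)

theorem itinerary_succ (T : X → X) (P : X → A) (n : ℕ) (x : X) :
    itinerary T P (n + 1) x =
      Fin.snoc (α := fun _ => A) (itinerary T P n x) (P (T^[n] x)) :=
  (Fin.snoc_init_self (α := fun _ => A) (itinerary T P (n + 1) x)).symm

theorem wordCost_itinerary (T : X → X) (P : X → A) {m : ℕ} (φ : (Fin (m + 1) → A) → ℝ) (n : ℕ)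
    (x : X) : wordCost φ n (itinerary T P (m + n) x) =
      birkhoffSum T (fun y => φ (itinerary T P (m + 1) y)) n x := by
  rw [wordCost, birkhoffSum,
    ← Fin.sum_univ_eq_sum_range fun j => φ (itinerary T P (m + 1) (T^[j] x))]
  refine Finset.sum_congr rfl fun j _ => congrArg φ (funext fun i => ?_)
  simp only [itinerary, ← Function.iterate_add_apply, add_comm]

variable [MeasurableSpace X]

theorem measurable_itinerary [MeasurableSpace A] {T : X → X} (hT : Measurable T) {P : X → A}
    (hP : Measurable P) (n : ℕ) : Measurable (itinerary T P n) :=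
  measurable_pi_lambda _ fun i => hP.comp (hT.iterate i)

theorem joinEntropy_eq_sum_itinerary (T : X → X) (μ : Measure X) {k : ℕ} (P : X → Fin k)
    (n : ℕ) :
    joinEntropy T μ P n = ∑ a, Real.negMulLog (μ.real (itinerary T P n ⁻¹' {a})) := by
  simp only [joinEntropy, Set.preimage, Set.mem_singleton_iff, itinerary, funext_iff]

theorem measureReal_itinerary_preimage_eq_sum [Fintype A] [MeasurableSpace A]
    [MeasurableSingletonClass A] {T : X → X} (hT : Measurable T) (μ : Measure X)
    [IsFiniteMeasure μ] {P : X → A} (hP : Measurable P) (n : ℕ) (b : Fin n → A) :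
    μ.real (itinerary T P n ⁻¹' {b}) =
      ∑ c, μ.real (itinerary T P (n + 1) ⁻¹' {Fin.snoc (α := fun _ => A) b c}) := by
  rw [← measureReal_iUnion_fintype]
  · congr 1
    ext x
    simp [itinerary_succ, Fin.snoc_inj]
  · intro c d hcd
    exact Disjoint.preimage _ (by simpa [Fin.snoc_inj] using hcd)
  · exact fun c => measurable_itinerary hT hP _ (measurableSet_singleton _)

theorem integral_comp_eq_sum_measureReal [Fintype A] [MeasurableSpace A]
    [MeasurableSingletonClass A] (μ : Measure X) [IsFiniteMeasure μ] {f : X → A}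
    (hf : Measurable f) (φ : A → ℝ) :
    ∫ x, φ (f x) ∂μ = ∑ a, μ.real (f ⁻¹' {a}) * φ a := by
  rw [← integral_map hf.aemeasurable (measurable_of_finite φ).aestronglyMeasurable,
    integral_fintype Integrable.of_finite]
  simp only [map_measureReal_apply hf (measurableSet_singleton _), smul_eq_mul]

theorem exists_joinEntropy_succ_sub_lt (T : X → X) (μ : Measure X) [IsProbabilityMeasure μ]
    {k : ℕ} (P : X → Fin k) {s : ℝ} (hs : partitionEntropy T μ P < ENNReal.ofReal s) :
    ∃ m, joinEntropy T μ P (m + 1) - joinEntropy T μ P m < s := by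
  by_contra! hincr
  have hlinear : ∀ n : ℕ, n * s ≤ joinEntropy T μ P n := by
    intro n
    induction n with
    | zero => simp [joinEntropy]
    | succ n ih => push_cast; linarith [hincr n]
  refine hs.not_ge (le_limsup_of_frequently_le (Eventually.frequently ?_))
  filter_upwards [eventually_gt_atTop 0] with n hn
  refine ENNReal.ofReal_le_ofReal ?_
  rw [le_div_iff₀ (by exact_mod_cast hn), mul_comm]
  exact hlinear n

theorem exists_isConditionalCode_integral_lt {T : X → X} (hT : Measurable T) (μ : Measure X)
    [IsProbabilityMeasure μ] {k : ℕ} {P : X → Fin k} (hP : Measurable P) {s : ℝ}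
    (hs : partitionEntropy T μ P < ENNReal.ofReal s) :
    ∃ (m : ℕ) (φ : (Fin (m + 1) → Fin k) → ℝ), IsConditionalCode φ ∧
      ∫ x, φ (itinerary T P (m + 1) x) ∂μ < s := by
  obtain ⟨m, hm⟩ := exists_joinEntropy_succ_sub_lt T μ P hs
  simp only [joinEntropy_eq_sum_itinerary, sum_words_snoc (n := m),
    measureReal_itinerary_preimage_eq_sum hT μ hP m] at hm
  obtain ⟨ℓ, hkraft, hcost⟩ := exists_kraft_sum_sum_mul_lt (fun _ _ => measureReal_nonneg) hm
  let φ : (Fin (m + 1) → Fin k) → ℝ := fun a =>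
    ℓ (Fin.init (α := fun _ => Fin k) a) (a (Fin.last m))
  have hφ : ∀ b c, φ (Fin.snoc (α := fun _ => Fin k) b c) = ℓ b c := by simp [φ]
  refine ⟨m, φ, fun b => by simpa only [hφ] using hkraft b, ?_⟩
  rw [integral_comp_eq_sum_measureReal μ (measurable_itinerary hT hP _), sum_words_snoc]
  simpa only [hφ] using hcost

end Itineraries

section Covers

variable {X : Type*} [MetricSpace X] (T : X → X)

theorem bowenMeasure_mono (s : ℝ≥0) (ε : ℝ) {Z Z' : Set X} (h : Z ⊆ Z') :
    bowenMeasure T s Z ε ≤ bowenMeasure T s Z' ε :=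
  iSup_mono fun _ => le_iInf₂ fun R hR =>
    iInf₂_le R ⟨hR.countable, hR.pos, hR.le, h.trans hR.cover⟩

theorem topEntropyAt_mono (ε : ℝ) {Z Z' : Set X} (h : Z ⊆ Z') :
    topEntropyAt T Z ε ≤ topEntropyAt T Z' ε :=
  iInf₂_mono' fun s hs => ⟨s, le_antisymm ((bowenMeasure_mono T s ε h).trans hs.le) zero_le, le_rfl⟩

theorem topEntropy_mono {Z Z' : Set X} (h : Z ⊆ Z') : topEntropy T Z ≤ topEntropy T Z' :=
  iSup₂_mono fun ε _ => topEntropyAt_mono T ε h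

theorem bowenPremeasure_iUnion_le {ι : Type*} [Countable ι] (s : ℝ≥0) (Z : ι → Set X) (ε : ℝ)
    (N : ℕ) : bowenPremeasure T s (⋃ i, Z i) ε N ≤ ∑' i, bowenPremeasure T s (Z i) ε N := by
  refine ENNReal.le_of_forall_pos_le_add fun δ hδ hfin => ?_
  obtain ⟨η, hη, hηδ⟩ := ENNReal.exists_pos_sum_of_countable' (ENNReal.coe_pos.2 hδ).ne' ι
  have hcover : ∀ i, ∃ R, IsBowenCover T (Z i) ε N R ∧
      coverWeight s R < bowenPremeasure T s (Z i) ε N + η i := fun i => by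
    simpa only [bowenPremeasure, iInf_lt_iff, exists_prop] using
      ENNReal.lt_add_right (ne_top_of_le_ne_top hfin.ne (ENNReal.le_tsum i)) (hη i).ne'
  choose R hR hweight using hcover
  calc bowenPremeasure T s (⋃ i, Z i) ε N
      ≤ coverWeight s (⋃ i, R i) := iInf₂_le _
        { countable := Set.countable_iUnion fun i => (hR i).countable
          pos := fun p hp => (Set.mem_iUnion.1 hp).elim fun i => (hR i).pos p
          le := fun p hp => (Set.mem_iUnion.1 hp).elim fun i => (hR i).le p
          cover := by
            rw [Set.biUnion_iUnion]
            exact Set.iUnion_mono fun i => (hR i).cover }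
    _ ≤ ∑' i, coverWeight s (R i) :=
        ENNReal.tsum_iUnion_le_tsum (fun p : ℕ × X => ENNReal.ofReal (Real.exp (-(s * p.1)))) R
    _ ≤ ∑' i, (bowenPremeasure T s (Z i) ε N + η i) :=
        ENNReal.tsum_le_tsum fun i => (hweight i).le
    _ ≤ ∑' i, bowenPremeasure T s (Z i) ε N + δ := by
        rw [ENNReal.tsum_add]
        gcongr

theorem bowenMeasure_iUnion_le {ι : Type*} [Countable ι] (s : ℝ≥0) (Z : ι → Set X) (ε : ℝ) :
    bowenMeasure T s (⋃ i, Z i) ε ≤ ∑' i, bowenMeasure T s (Z i) ε :=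
  iSup_le fun N => (bowenPremeasure_iUnion_le T s Z ε N).trans
    (ENNReal.tsum_le_tsum fun i => le_iSup (bowenPremeasure T s (Z i) ε) N)

theorem topEntropyAt_le_of_bowenMeasure_ne_top {Z : Set X} {ε : ℝ} {t : ℝ≥0∞}
    (h : ∀ s : ℝ≥0, t < s → bowenMeasure T s Z ε ≠ ⊤) : topEntropyAt T Z ε ≤ t := by
  by_contra! hlt
  obtain ⟨s, hts, hs⟩ := ENNReal.lt_iff_exists_nnreal_btwn.1 hlt
  exact h s hts (bowenMeasure_eq_top T Z ε s hs)

theorem topEntropyAt_iUnion_le {ι : Type*} [Countable ι] (Z : ι → Set X) (ε : ℝ) :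
    topEntropyAt T (⋃ i, Z i) ε ≤ ⨆ i, topEntropyAt T (Z i) ε := by
  refine topEntropyAt_le_of_bowenMeasure_ne_top T fun s hs =>
    ne_top_of_le_ne_top ENNReal.zero_ne_top ((bowenMeasure_iUnion_le T s Z ε).trans ?_)
  have hzero : ∀ i, bowenMeasure T s (Z i) ε = 0 := fun i =>
    bowenMeasure_eq_zero T (Z i) ε s ((le_iSup (fun i => topEntropyAt T (Z i) ε) i).trans_lt hs)
  simp [hzero]

theorem bowenPremeasure_le_tsum {ι : Type*} [Countable ι] (s : ℝ≥0) {Z : Set X} {ε : ℝ} {N : ℕ}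
    (n : ι → ℕ) (x : ι → X) (hn : ∀ i, max N 1 ≤ n i)
    (hcover : Z ⊆ ⋃ i, bowenBall T (n i) (x i) ε) :
    bowenPremeasure T s Z ε N ≤ ∑' i, ENNReal.ofReal (Real.exp (-(s * n i))) := by
  let f : ι → ℕ × X := fun i => (n i, x i)
  refine (iInf₂_le (Set.range f) ?_).trans (ENNReal.tsum_le_tsum_comp_of_surjective
    Set.rangeFactorization_surjective fun p : Set.range f => _)
  exact
    { countable := Set.countable_range f
      pos := Set.forall_mem_range.2 fun i => (le_max_right N 1).trans (hn i)
      le := Set.forall_mem_range.2 fun i => (le_max_left N 1).trans (hn i)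
      cover := by rwa [Set.biUnion_range] }

theorem mem_bowenBall_of_itinerary_eq {A : Type*} {P : X → A} {ε : ℝ}
    (hP : ∀ x y, P x = P y → dist x y < ε) {n N : ℕ} (hn : n ≤ N) {x y : X}
    (h : itinerary T P N y = itinerary T P N x) : y ∈ bowenBall T n x ε :=
  fun j hj => hP _ _ (congrFun h ⟨j, hj.trans_le hn⟩)

end Covers

section CodedPoints

variable {A : Type*} [Fintype A] {m : ℕ} {φ : (Fin (m + 1) → A) → ℝ}

theorem IsConditionalCode.tsum_ofReal_exp_ne_top (hφ : IsConditionalCode φ) {r : ℝ} (hr : r < 0) :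
    ∑' p : Σ n : ℕ, (Fin (m + n) → A),
      ENNReal.ofReal (Real.exp (r * p.1 - wordCost φ p.1 p.2)) ≠ ⊤ := by
  rw [ENNReal.tsum_sigma fun (n : ℕ) (a : Fin (m + n) → A) =>
    ENNReal.ofReal (Real.exp (r * n - wordCost φ n a))]
  have hlength : ∀ n : ℕ, ∑' a : Fin (m + n) → A,
      ENNReal.ofReal (Real.exp (r * n - wordCost φ n a)) ≤
        ENNReal.ofReal (Real.exp r ^ n * (Fintype.card A : ℝ) ^ m) := by
    intro n
    rw [tsum_fintype, ← ENNReal.ofReal_sum_of_nonneg fun _ _ => (Real.exp_pos _).le]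
    simp only [sub_eq_add_neg, Real.exp_add, ← Finset.mul_sum, mul_comm r, Real.exp_nat_mul]
    gcongr
    exact hφ.sum_exp_neg_wordCost_le n
  have hsummable : Summable fun n : ℕ => Real.exp r ^ n * (Fintype.card A : ℝ) ^ m :=
    (summable_geometric_of_lt_one (Real.exp_pos r).le (Real.exp_lt_one_iff.2 hr)).mul_right _
  exact ne_top_of_le_ne_top hsummable.tsum_ofReal_ne_top (ENNReal.tsum_le_tsum hlength)

variable {X : Type*} [MetricSpace X] (T : X → X) {P : X → A} {ε : ℝ}

theorem IsConditionalCode.bowenMeasure_ne_top (hφ : IsConditionalCode φ)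
    (hP : ∀ x y, P x = P y → dist x y < ε) {s : ℝ} {s' : ℝ≥0} (hs : s < s') :
    bowenMeasure T s' {x | ∃ᶠ n : ℕ in atTop,
      birkhoffSum T (fun y => φ (itinerary T P (m + 1) y)) n x ≤ s * n} ε ≠ ⊤ := by
  refine ne_top_of_le_ne_top (hφ.tsum_ofReal_exp_ne_top (sub_neg.2 hs)) (iSup_le fun N => ?_)
  let S : Set (Σ n : ℕ, (Fin (m + n) → A)) := {p | max N 1 ≤ p.1 ∧
    wordCost φ p.1 p.2 ≤ s * p.1 ∧ ∃ x, itinerary T P (m + p.1) x = p.2}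
  choose x hx using fun p : S => p.2.2.2
  calc _ ≤ ∑' p : S, ENNReal.ofReal (Real.exp (-(s' * (p.1.1 : ℕ)))) := by
        refine bowenPremeasure_le_tsum T s' (fun p : S => p.1.1) x (fun p => p.2.1) fun y hy => ?_
        obtain ⟨n, hn, hyn⟩ := frequently_atTop.1 hy (max N 1)
        rw [← wordCost_itinerary] at hyn
        let p : S := ⟨⟨n, itinerary T P (m + n) y⟩, hn, hyn, y, rfl⟩
        exact Set.mem_iUnion.2
          ⟨p, mem_bowenBall_of_itinerary_eq T hP (Nat.le_add_left n m) (hx p).symm⟩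
    _ ≤ ∑' p : S, ENNReal.ofReal (Real.exp ((s - s') * p.1.1 - wordCost φ p.1.1 p.1.2)) := by
        refine ENNReal.tsum_le_tsum fun p => ENNReal.ofReal_le_ofReal (Real.exp_le_exp.2 ?_)
        linarith [p.2.2.1]
    _ ≤ _ := ENNReal.tsum_comp_le_tsum_of_injective Subtype.val_injective _

theorem IsConditionalCode.topEntropyAt_le (hφ : IsConditionalCode φ)
    (hP : ∀ x y, P x = P y → dist x y < ε) (s : ℝ≥0) :
    topEntropyAt T {x | ∃ᶠ n : ℕ in atTop,
      birkhoffSum T (fun y => φ (itinerary T P (m + 1) y)) n x ≤ s * n} ε ≤ s :=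
  topEntropyAt_le_of_bowenMeasure_ne_top T fun _ hs =>
    hφ.bowenMeasure_ne_top T hP (by exact_mod_cast hs)

end CodedPoints

section NullFrontiers

variable {X : Type*} [TopologicalSpace X] [MeasurableSpace X]

theorem measure_frontier_iInter_eq_zero {μ : Measure X} {ι : Type*} [Finite ι] {s : ι → Set X}
    (hs : ∀ i, μ (frontier (s i)) = 0) : μ (frontier (⋂ i, s i)) = 0 := by
  classical
  have := Fintype.ofFinite ι
  have hfinset : ∀ t : Finset ι, μ (frontier (⋂ i ∈ t, s i)) = 0 := by
    intro t
    induction t using Finset.induction_on with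
    | empty => simp
    | insert i t _ ih =>
      rw [Finset.set_biInter_insert]
      exact null_frontier_inter (hs i) ih
  simpa using hfinset Finset.univ

theorem measure_frontier_pi_preimage_singleton_eq_zero {μ : Measure X} {ι A : Type*} [Finite ι]
    {f : X → ι → A} (hf : ∀ i a, μ (frontier ((fun x => f x i) ⁻¹' {a})) = 0) (a : ι → A) :
    μ (frontier (f ⁻¹' {a})) = 0 := by
  have hpre : f ⁻¹' {a} = ⋂ i, (fun x => f x i) ⁻¹' {a i} := by
    ext x
    simp [funext_iff]
  rw [hpre]
  exact measure_frontier_iInter_eq_zero fun i => hf i (a i)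

theorem measure_frontier_itinerary_eq_zero [OpensMeasurableSpace X] {T : X → X}
    (hT : Continuous T) {μ : Measure X} (hμ : MeasurePreserving T μ μ) {A : Type*} {P : X → A}
    (hP : ∀ a, μ (frontier (P ⁻¹' {a})) = 0) (n : ℕ) (a : Fin n → A) :
    μ (frontier (itinerary T P n ⁻¹' {a})) = 0 := by
  refine measure_frontier_pi_preimage_singleton_eq_zero (fun i b => ?_) a
  refine measure_mono_null ((hT.iterate i).frontier_preimage_subset (P ⁻¹' {b})) ?_
  rw [(hμ.iterate i).measure_preimage isClosed_frontier.measurableSet.nullMeasurableSet]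
  exact hP b

theorem tendsto_integral_of_null_frontier_fibers [OpensMeasurableSpace X]
    [HasOuterApproxClosed X] {A : Type*} [Finite A] [MeasurableSpace A]
    [MeasurableSingletonClass A] {μ : ProbabilityMeasure X} {f : X → A} (hf : Measurable f)
    (hfr : ∀ a, (μ : Measure X) (frontier (f ⁻¹' {a})) = 0) (φ : A → ℝ) :
    Tendsto (fun ν : ProbabilityMeasure X => ∫ x, φ (f x) ∂(ν : Measure X)) (𝓝 μ)
      (𝓝 (∫ x, φ (f x) ∂(μ : Measure X))) := by
  have := Fintype.ofFinite A
  simp only [integral_comp_eq_sum_measureReal _ hf]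
  refine tendsto_finsetSum _ fun a _ => Tendsto.mul_const _ ?_
  exact (ENNReal.tendsto_toReal (measure_ne_top _ _)).comp
    (ProbabilityMeasure.tendsto_measure_of_null_frontier_of_tendsto' tendsto_id (hfr a))

end NullFrontiers

theorem exists_partition_null_frontier {X : Type*} [PseudoMetricSpace X] [CompactSpace X]
    [MeasurableSpace X] [OpensMeasurableSpace X] (μ : Measure X) [IsFiniteMeasure μ] {ε : ℝ}
    (hε : 0 < ε) : ∃ (k : ℕ) (P : X → Fin k), Measurable P ∧
      (∀ x y, P x = P y → dist x y < ε) ∧ ∀ i, μ (frontier (P ⁻¹' {i})) = 0 := by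
  classical
  choose r hr hr0 using fun x : X => exists_null_frontier_thickening μ {x} (half_pos hε)
  simp only [Metric.thickening_singleton] at hr0
  obtain ⟨t, ht⟩ := isCompact_univ.elim_finite_subcover (fun x : X => Metric.ball x (r x))
    (fun x => Metric.isOpen_ball) fun x _ => Set.mem_iUnion.2 ⟨x, Metric.mem_ball_self (hr x).1⟩
  let Q : X → t → Prop := fun x c => x ∈ Metric.ball (c : X) (r c)
  let e := Fintype.equivFin (t → Prop)
  have hfiber : ∀ i, (e ∘ Q) ⁻¹' {i} = Q ⁻¹' {e.symm i} := fun i => by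
    ext x
    simp [Equiv.eq_symm_apply]
  have hQ : Measurable Q := measurable_pi_lambda _ fun c =>
    measurableSet_setOfPred.1 measurableSet_ball
  refine ⟨_, e ∘ Q, (measurable_of_finite e).comp hQ, fun x y hxy => ?_, fun i => ?_⟩
  · obtain ⟨c, hc, hx⟩ := Set.mem_iUnion₂.1 (ht (Set.mem_univ x))
    have hy : y ∈ Metric.ball c (r c) := (congrFun (e.injective hxy) ⟨c, hc⟩).mp hx
    linarith [dist_triangle_right x y c, Metric.mem_ball.1 hx, Metric.mem_ball.1 hy, (hr c).2]
  · rw [hfiber]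
    refine measure_frontier_pi_preimage_singleton_eq_zero (fun c p => ?_) _
    by_cases hp : p
    · have : (fun x => Q x c) ⁻¹' {p} = Metric.ball (c : X) (r c) := by ext x; simp [Q, hp]
      rw [this, hr0]
    · have : (fun x => Q x c) ⁻¹' {p} = (Metric.ball (c : X) (r c))ᶜ := by ext x; simp [Q, hp]
      rw [this, frontier_compl, hr0]

section LimitMeasures

variable {X : Type*} [MeasurableSpace X]

theorem integral_empiricalMeasure [MeasurableSingletonClass X] {F : Type*}
    [NormedAddCommGroup F] [NormedSpace ℝ F] [CompleteSpace F] (T : X → X) (x : X) (n : ℕ)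
    (f : X → F) :
    ∫ y, f y ∂(empiricalMeasure T x n : Measure X) = birkhoffAverage ℝ T f (n + 1) x := by
  change ∫ y, f y ∂(((n + 1 : ℕ) : ℝ≥0∞)⁻¹ •
    ∑ j ∈ Finset.range (n + 1), Measure.dirac (T^[j] x)) = _
  rw [integral_smul_measure, integral_finsetSum_measure fun j _ => integrable_dirac (by simp)]
  simp only [integral_dirac, ENNReal.toReal_inv, ENNReal.toReal_natCast, birkhoffAverage,
    birkhoffSum]

variable [TopologicalSpace X]

theorem tendsto_integral_comp_sub_integral_empiricalMeasure [CompactSpace X]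
    [MeasurableSingletonClass X] (T : X → X) (x : X) (f : C(X, ℝ)) :
    Tendsto (fun n => ∫ y, f (T y) ∂(empiricalMeasure T x n : Measure X) -
      ∫ y, f y ∂(empiricalMeasure T x n : Measure X)) atTop (𝓝 0) := by
  have hbdd : Bornology.IsBounded (Set.range f) := (isCompact_range f.continuous).isBounded
  refine ((tendsto_add_atTop_iff_nat 1).2
    (tendsto_birkhoffAverage_apply_sub_birkhoffAverage' ℝ hbdd T x)).congr fun n => ?_
  rw [integral_empiricalMeasure T x n fun y => f (T y), integral_empiricalMeasure]
  simp only [birkhoffAverage, birkhoffSum, ← Function.iterate_succ_apply,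
    Function.iterate_succ_apply']

/-- The set `V(x)` of limit measures of `x`: the weak limits of subsequences of the empirical
measures of `x`. It is encoded by cluster points, which is equivalent since the space of
probability measures on a compact metric space is metrizable. -/
def limitMeasures [OpensMeasurableSpace X] (T : X → X) (x : X) : Set (ProbabilityMeasure X) :=
  {μ | MapClusterPt μ atTop (empiricalMeasure T x)}

variable [BorelSpace X]

theorem mem_invariantMeasures_iff [CompactSpace X] [HasOuterApproxClosed X] {T : X → X}
    (hT : Continuous T) {μ : ProbabilityMeasure X} : μ ∈ invariantMeasures T ↔
      ∀ f : C(X, ℝ), ∫ x, f (T x) ∂(μ : Measure X) = ∫ x, f x ∂(μ : Measure X) := by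
  have hmap : ∀ f : C(X, ℝ),
      ∫ x, f x ∂((μ : Measure X).map T) = ∫ x, f (T x) ∂(μ : Measure X) := fun f =>
    integral_map hT.aemeasurable f.continuous.aestronglyMeasurable
  refine ⟨fun h f => ?_, fun h => ⟨hT.measurable, ?_⟩⟩
  · rw [← hmap, MeasurePreserving.map_eq h]
  · have := Measure.isProbabilityMeasure_map (μ := (μ : Measure X)) hT.aemeasurable
    exact ext_of_forall_integral_eq_of_IsFiniteMeasure fun f =>
      (hmap f.toContinuousMap).trans (h f.toContinuousMap)

variable [CompactSpace X]

theorem limitMeasures_subset_invariantMeasures [HasOuterApproxClosed X]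
    [MeasurableSingletonClass X] {T : X → X} (hT : Continuous T) (x : X) :
    limitMeasures T x ⊆ invariantMeasures T := by
  intro μ hμ
  obtain ⟨U, hU, hUμ⟩ := mapClusterPt_iff_ultrafilter.1 hμ
  refine (mem_invariantMeasures_iff hT).2 fun f => sub_eq_zero.1 ?_
  have hcont : ∀ g : C(X, ℝ), Tendsto
      (fun n => ∫ y, g y ∂(empiricalMeasure T x n : Measure X)) U
        (𝓝 (∫ y, g y ∂(μ : Measure X))) := fun g =>
    ((ProbabilityMeasure.continuous_integral_continuousMap g).tendsto μ).comp hUμ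
  exact tendsto_nhds_unique ((hcont (f.comp ⟨T, hT⟩)).sub (hcont f))
    ((tendsto_integral_comp_sub_integral_empiricalMeasure T x f).mono_left hU)

theorem limitMeasures_nonempty [T2Space X] (T : X → X) (x : X) : (limitMeasures T x).Nonempty :=
  exists_clusterPt_of_compactSpace (map (empiricalMeasure T x) atTop)

theorem mem_genericPoints_iff [T2Space X] [HasOuterApproxClosed X] {T : X → X}
    {μ : ProbabilityMeasure X} {x : X} :
    x ∈ genericPoints T μ ↔ limitMeasures T x ⊆ {μ} := by
  refine ⟨fun hx ν hν => ?_, fun h => tendsto_nhds_of_unique_mapClusterPt fun ν hν => h hν⟩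
  obtain ⟨U, hU, hUν⟩ := mapClusterPt_iff_ultrafilter.1 hν
  exact tendsto_nhds_unique hUν (Tendsto.mono_left hx hU)

end LimitMeasures

section BowenBound

theorem partitionEntropy_le_measureEntropy {X : Type*} [MeasurableSpace X] (T : X → X)
    (μ : Measure X) {k : ℕ} {P : X → Fin k} (hP : Measurable P) :
    partitionEntropy T μ P ≤ measureEntropy T μ :=
  le_iSup_of_le k <| le_iSup₂_of_le (f := fun Q (_ : Measurable Q) => partitionEntropy T μ Q) P hP
    le_rfl

variable {X : Type*} [MetricSpace X] [CompactSpace X] [MeasurableSpace X] [BorelSpace X]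
  {T : X → X}

theorem exists_open_topEntropyAt_frequently_empiricalMeasure_mem_le (hT : Continuous T)
    {μ : ProbabilityMeasure X} (hμ : μ ∈ invariantMeasures T) {s : ℝ≥0}
    (hs : measureEntropy T (μ : Measure X) < s) {ε : ℝ} (hε : 0 < ε) :
    ∃ W : Set (ProbabilityMeasure X), IsOpen W ∧ μ ∈ W ∧
      topEntropyAt T {x | ∃ᶠ n in atTop, empiricalMeasure T x n ∈ W} ε ≤ s := by
  obtain ⟨k, P, hP, hPε, hP0⟩ := exists_partition_null_frontier (μ : Measure X) hε
  have hPs : partitionEntropy T (μ : Measure X) P < ENNReal.ofReal s := by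
    rw [ENNReal.ofReal_coe_nnreal]
    exact (partitionEntropy_le_measureEntropy T _ hP).trans_lt hs
  obtain ⟨m, φ, hφ, hcost⟩ := exists_isConditionalCode_integral_lt hT.measurable _ hP hPs
  obtain ⟨W, hWcost, hWopen, hμW⟩ := mem_nhds_iff.1 <|
    (tendsto_integral_of_null_frontier_fibers (measurable_itinerary hT.measurable hP (m + 1))
      (measure_frontier_itinerary_eq_zero hT hμ hP0 (m + 1)) φ).eventually (gt_mem_nhds hcost)
  refine ⟨W, hWopen, hμW, (topEntropyAt_mono T ε fun x hx => ?_).trans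
    (hφ.topEntropyAt_le T hPε s)⟩
  refine (tendsto_add_atTop_nat 1).frequently (Frequently.mono hx fun n hn => ?_)
  have hlt : ∫ y, φ (itinerary T P (m + 1) y) ∂(empiricalMeasure T x n : Measure X) < s :=
    hWcost hn
  rw [integral_empiricalMeasure T x n fun y => φ (itinerary T P (m + 1) y), birkhoffAverage,
    smul_eq_mul, inv_mul_lt_iff₀ (by positivity), mul_comm] at hlt
  exact hlt.le

theorem topEntropy_exists_limitMeasure_entropy_le (hT : Continuous T) (t : ℝ≥0∞) :
    topEntropy T {x | ∃ μ ∈ limitMeasures T x, measureEntropy T (μ : Measure X) ≤ t} ≤ t := by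
  refine iSup₂_le fun ε hε => le_of_forall_gt_imp_ge_of_dense fun c hc => ?_
  obtain ⟨s, hts, hsc⟩ := ENNReal.lt_iff_exists_nnreal_btwn.1 hc
  let M : Set (ProbabilityMeasure X) :=
    {μ | μ ∈ invariantMeasures T ∧ measureEntropy T (μ : Measure X) ≤ t}
  choose W hWopen hmem hW using fun μ : M =>
    exists_open_topEntropyAt_frequently_empiricalMeasure_mem_le hT μ.2.1
      (μ.2.2.trans_lt hts) hε
  have : SecondCountableTopology (ProbabilityMeasure X) := by
    let := TopologicalSpace.metrizableSpaceMetric (ProbabilityMeasure X)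
    infer_instance
  obtain ⟨S, hS, hSW⟩ := TopologicalSpace.isOpen_iUnion_countable W hWopen
  have := hS.to_subtype
  have hcover : {x | ∃ μ ∈ limitMeasures T x, measureEntropy T (μ : Measure X) ≤ t} ⊆
      ⋃ μ : S, {x | ∃ᶠ n in atTop, empiricalMeasure T x n ∈ W μ} := by
    rintro x ⟨μ, hμ, hμt⟩
    have hμM : μ ∈ M := ⟨limitMeasures_subset_invariantMeasures hT x hμ, hμt⟩
    have hμW : μ ∈ ⋃ ν ∈ S, W ν := hSW ▸ Set.mem_iUnion.2 ⟨⟨μ, hμM⟩, hmem _⟩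
    obtain ⟨ν, hνS, hμν⟩ := Set.mem_iUnion₂.1 hμW
    exact Set.mem_iUnion.2 ⟨⟨ν, hνS⟩, hμ.frequently ((hWopen ν).mem_nhds hμν)⟩
  calc topEntropyAt T {x | ∃ μ ∈ limitMeasures T x, measureEntropy T (μ : Measure X) ≤ t} ε
      ≤ ⨆ μ : S, topEntropyAt T {x | ∃ᶠ n in atTop, empiricalMeasure T x n ∈ W μ} ε :=
        (topEntropyAt_mono T ε hcover).trans (topEntropyAt_iUnion_le T _ ε)
    _ ≤ s := iSup_le fun μ => hW μ
    _ ≤ c := hsc.le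

end BowenBound

section BirkhoffSets

theorem mapClusterPt_comp_iff_exists {Y Z ι : Type*} [TopologicalSpace Y] [CompactSpace Y]
    [TopologicalSpace Z] [T2Space Z] {l : Filter ι} {g : Y → Z} (hg : Continuous g) {u : ι → Y}
    {z : Z} : MapClusterPt z l (g ∘ u) ↔ ∃ y, MapClusterPt y l u ∧ g y = z := by
  constructor
  · intro hz
    obtain ⟨U, hU, hUz⟩ := mapClusterPt_iff_ultrafilter.1 hz
    obtain ⟨y, hUy⟩ : ∃ y, Tendsto u U (𝓝 y) := ⟨_, (U.map u).le_nhds_lim⟩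
    exact ⟨y, mapClusterPt_iff_ultrafilter.2 ⟨U, hU, hUy⟩,
      tendsto_nhds_unique ((hg.tendsto y).comp hUy) hUz⟩
  · rintro ⟨y, hy, rfl⟩
    exact hy.continuousAt_comp hg.continuousAt

theorem limsup_comp_le_iff_forall_mapClusterPt {Y ι R : Type*} [TopologicalSpace Y]
    [CompactSpace Y] [ConditionallyCompleteLinearOrder R] [TopologicalSpace R] [OrderTopology R]
    {l : Filter ι} [NeBot l] {g : Y → R} (hg : Continuous g) (u : ι → Y) {c : R} :
    limsup (g ∘ u) l ≤ c ↔ ∀ y, MapClusterPt y l u → g y ≤ c := by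
  have hrange : Set.range (g ∘ u) ⊆ Set.range g := Set.range_comp_subset_range u g
  have : Nonempty R := ⟨c⟩
  have hlimsup := isGreatest_mapClusterPt_limsup (f := l)
    ((isCompact_range hg).bddBelow.mono hrange).isBoundedUnder_of_range.isCoboundedUnder_le
    ((isCompact_range hg).bddAbove.mono hrange).isBoundedUnder_of_range
  rw [isLUB_le_iff hlimsup.isLUB]
  simp only [mem_upperBounds, Set.mem_ofPred_eq, mapClusterPt_comp_iff_exists hg,
    forall_exists_index, and_imp, forall_apply_eq_imp_iff₂]

variable {X : Type*} {B : Type*} [NormedAddCommGroup B] [NormedSpace ℝ B]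

theorem birkhoffAverage_weakDual_apply (T : X → X) (Φ : X → WeakDual ℝ B) (n : ℕ) (x : X)
    (w : B) : birkhoffAverage ℝ T Φ n x w = birkhoffAverage ℝ T (fun y => Φ y w) n x :=
  map_birkhoffAverage ℝ ℝ (WeakBilin.eval (topDualPairing ℝ B) w) T Φ n x

section Topological

variable [TopologicalSpace X] [CompactSpace X] [T2Space X] [MeasurableSpace X]
  [BorelSpace X] {T : X → X} {Φ : X → WeakDual ℝ B}

theorem limsup_birkhoffAverage_le_iff (T : X → X) (hΦ : Continuous Φ) (x : X) (w : B) {c : ℝ} :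
    limsup (fun n => birkhoffAverage ℝ T Φ n x w) atTop ≤ c ↔
      ∀ μ ∈ limitMeasures T x, ∫ y, Φ y w ∂(μ : Measure X) ≤ c := by
  let f : C(X, ℝ) := ⟨fun y => Φ y w, (WeakDual.eval_continuous w).comp hΦ⟩
  have havg : ∀ n, birkhoffAverage ℝ T Φ (n + 1) x w =
      ∫ y, f y ∂(empiricalMeasure T x n : Measure X) := fun n => by
    rw [birkhoffAverage_weakDual_apply, integral_empiricalMeasure T x n f]
    rfl
  rw [← limsup_nat_add _ 1, funext havg]
  exact limsup_comp_le_iff_forall_mapClusterPt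
    (ProbabilityMeasure.continuous_integral_continuousMap f) (empiricalMeasure T x)

variable [HasOuterApproxClosed X]

theorem mem_birkhoffSet_iff (hT : Continuous T) (hΦ : Continuous Φ) {α : WeakDual ℝ B}
    {E : Set B} {x : X} :
    x ∈ birkhoffSet T Φ α E ↔ limitMeasures T x ⊆ birkhoffMeasures T Φ α E :=
  ⟨fun hx _ hμ => ⟨limitMeasures_subset_invariantMeasures hT x hμ, fun w hw =>
      (limsup_birkhoffAverage_le_iff T hΦ x w).1 (hx w hw) _ hμ⟩,
    fun hx w hw => (limsup_birkhoffAverage_le_iff T hΦ x w).2 fun _ hμ => (hx hμ).2 w hw⟩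

theorem genericPoints_subset_birkhoffSet (hT : Continuous T) (hΦ : Continuous Φ)
    {α : WeakDual ℝ B} {E : Set B} {μ : ProbabilityMeasure X}
    (hμ : μ ∈ birkhoffMeasures T Φ α E) : genericPoints T μ ⊆ birkhoffSet T Φ α E := fun _ hx =>
  (mem_birkhoffSet_iff hT hΦ).2 <|
    (mem_genericPoints_iff.1 hx).trans (Set.singleton_subset_iff.2 hμ)

theorem birkhoffSet_eq_genericPoints (hT : Continuous T) (hΦ : Continuous Φ)
    {α : WeakDual ℝ B} {E : Set B} {μ : ProbabilityMeasure X}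
    (h : birkhoffMeasures T Φ α E = {μ}) : birkhoffSet T Φ α E = genericPoints T μ :=
  Set.ext fun _ => by rw [mem_birkhoffSet_iff hT hΦ, h, mem_genericPoints_iff]

end Topological

variable [MetricSpace X] [CompactSpace X] [MeasurableSpace X] [BorelSpace X] {T : X → X}
  {Φ : X → WeakDual ℝ B}

theorem topEntropy_birkhoffSet_le (hT : Continuous T) (hΦ : Continuous Φ) (α : WeakDual ℝ B)
    (E : Set B) : topEntropy T (birkhoffSet T Φ α E) ≤
      ⨆ μ ∈ birkhoffMeasures T Φ α E, measureEntropy T (μ : Measure X) := by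
  refine (topEntropy_mono T fun x hx => ?_).trans (topEntropy_exists_limitMeasure_entropy_le hT _)
  obtain ⟨μ, hμ⟩ := limitMeasures_nonempty T x
  exact ⟨μ, hμ, le_iSup₂_of_le μ ((mem_birkhoffSet_iff hT hΦ).1 hx hμ) le_rfl⟩

theorem IsSaturated.topEntropy_birkhoffSet (hsat : IsSaturated T) (hT : Continuous T)
    (hΦ : Continuous Φ) (α : WeakDual ℝ B) (E : Set B) :
    topEntropy T (birkhoffSet T Φ α E) =
      ⨆ μ ∈ birkhoffMeasures T Φ α E, measureEntropy T (μ : Measure X) := by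
  refine le_antisymm (topEntropy_birkhoffSet_le hT hΦ α E) (iSup₂_le fun _ hμ => ?_)
  rw [← hsat _ hμ.1]
  exact topEntropy_mono T (genericPoints_subset_birkhoffSet hT hΦ hμ)

end BirkhoffSets

section TestSpace

universe u v

theorem small_of_separable_metricSpace (X : Type u) [MetricSpace X]
    [TopologicalSpace.SeparableSpace X] : Small.{v} X :=
  small_of_injective (kuratowskiEmbedding.isometry X).injective

theorem eq_of_forall_integral_le {X : Type*} [TopologicalSpace X] [HasOuterApproxClosed X]
    [CompactSpace X] [MeasurableSpace X] [BorelSpace X] {μ ν : Measure X} [IsFiniteMeasure μ]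
    [IsFiniteMeasure ν] (h : ∀ f : C(X, ℝ), ∫ x, f x ∂μ ≤ ∫ x, f x ∂ν) : μ = ν := by
  refine ext_of_forall_integral_eq_of_IsFiniteMeasure fun f =>
    (h f.toContinuousMap).antisymm (neg_le_neg_iff.1 ?_)
  rw [← integral_neg, ← integral_neg]
  exact h (-f.toContinuousMap)

variable {X : Type u} {Y : Type v} [TopologicalSpace X] [TopologicalSpace Y]

/-- The map `x ↦ δ_{e x}` into the dual of `C(Y, ℝ)`; for `e` the identity it embeds `X` into the
dual of `C(X, ℝ)`. The space `Y` is a copy of `X` which may live in another universe. -/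
noncomputable def evalDual (e : C(X, Y)) (x : X) : WeakDual ℝ C(Y, ℝ) :=
  StrongDual.toWeakDual (ContinuousMap.evalCLM ℝ (e x))

theorem evalDual_apply (e : C(X, Y)) (x : X) (f : C(Y, ℝ)) : evalDual e x f = f (e x) :=
  rfl

theorem continuous_evalDual (e : C(X, Y)) : Continuous (evalDual e) :=
  WeakDual.continuous_of_continuous_eval fun f => f.continuous.comp e.continuous

variable [CompactSpace X] [CompactSpace Y] [MeasurableSpace X]

/-- The functional `f ↦ ∫ f ∘ e ∂μ` on `C(Y, ℝ)`, the barycenter of `evalDual e`. -/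
noncomputable def integralDual [OpensMeasurableSpace X] (e : C(X, Y)) (μ : ProbabilityMeasure X) :
    WeakDual ℝ C(Y, ℝ) :=
  StrongDual.toWeakDual <| LinearMap.mkContinuous
    { toFun := fun f => ∫ x, f (e x) ∂(μ : Measure X)
      map_add' := fun f g => integral_add
        ((f.comp e).continuous.integrable_of_hasCompactSupport (.of_compactSpace _))
        ((g.comp e).continuous.integrable_of_hasCompactSupport (.of_compactSpace _))
      map_smul' := fun c f => integral_const_mul c fun x => f (e x) } 1 fun f => by
    refine (norm_integral_le_of_norm_le_const
      (ae_of_all _ fun x => f.norm_coe_le_norm (e x))).trans ?_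
    simp

theorem integralDual_apply [OpensMeasurableSpace X] (e : C(X, Y)) (μ : ProbabilityMeasure X)
    (f : C(Y, ℝ)) : integralDual e μ f = ∫ x, f (e x) ∂(μ : Measure X) :=
  rfl

theorem birkhoffMeasures_evalDual [BorelSpace X] [HasOuterApproxClosed X] (e : X ≃ₜ Y)
    {T : X → X} {μ : ProbabilityMeasure X} (hμ : μ ∈ invariantMeasures T) :
    birkhoffMeasures T (evalDual (e : C(X, Y))) (integralDual (e : C(X, Y)) μ) Set.univ = {μ} := by
  refine Set.eq_singleton_iff_unique_mem.2 ⟨⟨hμ, fun f _ => le_rfl⟩, fun ν hν => ?_⟩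
  refine Subtype.ext (eq_of_forall_integral_le (μ := (ν : Measure X)) (ν := (μ : Measure X))
    fun f => ?_)
  simpa [evalDual_apply, integralDual_apply] using hν.2 (f.comp (e.symm : C(Y, X))) trivial

end TestSpace

theorem exists_birkhoffMeasures_eq_singleton.{u, v} {X : Type u} [MetricSpace X] [CompactSpace X]
    [MeasurableSpace X] [BorelSpace X] {T : X → X} {μ : ProbabilityMeasure X}
    (hμ : μ ∈ invariantMeasures T) :
    ∃ (B : Type v) (_ : NormedAddCommGroup B) (_ : NormedSpace ℝ B) (_ : CompleteSpace B)
      (Φ : X → WeakDual ℝ B) (α : WeakDual ℝ B), Continuous Φ ∧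
        birkhoffMeasures T Φ α Set.univ = {μ} := by
  have := small_of_separable_metricSpace.{u, v} X
  let e := Shrink.homeomorph.{v} X
  have : CompactSpace (Shrink.{v} X) := e.compactSpace
  exact ⟨C(Shrink.{v} X, ℝ), inferInstance, inferInstance, inferInstance, evalDual e,
    integralDual e μ, continuous_evalDual _, birkhoffMeasures_evalDual e hμ⟩

end SaturatedSystem

theorem mainTheorem5 {X : Type*} [MetricSpace X] [CompactSpace X] [MeasurableSpace X]
    [BorelSpace X] (T : X → X) (hT : Continuous T) :
    SaturatedSystem.IsSaturated T ↔
      ∀ (B : Type*) [NormedAddCommGroup B] [NormedSpace ℝ B] [CompleteSpace B]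
        (Φ : X → WeakDual ℝ B), Continuous Φ →
        ∀ (α : WeakDual ℝ B) (E : Set B),
          (SaturatedSystem.birkhoffMeasures T Φ α E).Nonempty →
          SaturatedSystem.topEntropy T (SaturatedSystem.birkhoffSet T Φ α E) =
            ⨆ μ ∈ SaturatedSystem.birkhoffMeasures T Φ α E,
              SaturatedSystem.measureEntropy T (μ : Measure X) := by
  refine ⟨fun hsat B _ _ _ Φ hΦ α E _ => hsat.topEntropy_birkhoffSet hT hΦ α E, fun h μ hμ => ?_⟩
  obtain ⟨B, _, _, _, Φ, α, hΦ, hM⟩ :=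
    SaturatedSystem.exists_birkhoffMeasures_eq_singleton hμ
  have hentropy := h B Φ hΦ α Set.univ (by simp only [hM, Set.singleton_nonempty])
  rwa [SaturatedSystem.birkhoffSet_eq_genericPoints hT hΦ hM, hM, iSup_singleton] at hentropy
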